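/- Let $\mathbb X,\mathbb Y$ be finite-dimensional real Hilbert spaces, $\lambda>0$, $b\in\mathbb Y$, $A:\mathbb X\to\mathbb Y$ a surjective linear map with adjoint $A^*$, and $f:\mathbb X\to\mathbb R\cup\{\pm\infty\}$ proper and lower semicontinuous. Put $\operatorname{dom} f=\{x: f(x)<+\infty\}$, $\mathcal E=\{x: Ax=b\}$, $\mathcal F=\operatorname{dom} f\cap\mathcal E$, let $\delta_{\mathcal E}$ be the indicator function of $\mathcal E$ ($0$ on $\mathcal E$, $+\infty$ elsewhere), let $\mathbb B_r(x)$ be the open ball of radius $r$ about $x$, and $\operatorname{Prox}_{g}(t)=\operatorname{argmin}_x\{g(x)+\tfrac12\|x-t\|^2\}$ (a set). Write $\partial$ for the limiting subdifferential: $v\in\partial g(x)$ iff $g(x)$ is finite and there are $x_k\to x$ with $g(x_k)\to g(x)$ and $v_k\to v$ such that, for each $k$, $g(x_k)$ is finite and $g(x')\ge g(x_k)+\langle v_k,x'-x_k\rangle+o(\|x'-x_k\|)$ as $x'\to x_k$. For $z\in\mathbb X$ consider $$(P)\qquad \min_x\ \{\lambda f(x)+\tfrac12\|x-z\|^2 :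 Ax=b\},$$ with Lagrangian $L_z(x,y)=\lambda f(x)+\tfrac12\|x-z\|^2+\langle y,b-Ax\rangle$ and dual problem $(D)$: $\max_{y}\inf_x L_z(x,y)$. Assume that $f$ is prox-bounded with threshold greater than $\lambda$, i.e. the supremum $\lambda_f$ of all $\gamma>0$ such that $\inf_x\{\gamma f(x)+\tfrac12\|x-t\|^2\}>-\infty$ for some $t\in\mathbb X$ satisfies $\lambda_f>\lambda$ (there being at least one such $\gamma$). Let $\bar x\in\mathcal F$ and suppose: (i) (NSSR of $f$ and $\delta_{\mathcal E}$ at $\bar x$) there are $\tau,\delta>0$ such that for all $x\in\mathbb B_\delta(\bar x)\cap\mathcal F$ and $d\in(0,1]$, $$\partial(f+\delta_{\mathcal E})(x)\cap\mathbb B_d(0)\subseteq \big(\partial f(x)\cap\tau\mathbb B_d(0)\big)+\big(\partial\delta_{\mathcal E}(x)\cap\tau\mathbb B_d(0)\big);$$ (ii) for some $\rho\in(0,1/\lambda)$, $\operatorname{Prox}_{f/\rho}(\bar x)=\{\bar x\}$ and $f$ is prox-regular at $\bar x$ for $0$ with constant $\rho$: $f$ is finite and locally lower semicontinuous at $\bar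 x$, $0\in\partial f(\bar x)$, and there is $\epsilon>0$ such that $$f(x')\ge f(x)+\langle v,x'-x\rangle-\tfrac{\rho}{2}\|x'-x\|^2\quad\text{for all } x'\in\mathbb B_\epsilon(\bar x)$$ whenever $x\in\mathbb B_\epsilon(\bar x)$, $f(x)<f(\bar x)+\epsilon$ and $v\in\partial f(x)\cap\mathbb B_\epsilon(0)$. Then $(P)$ is dual-representable for all $z$ near $\bar x$: there is a neighborhood $U$ of $\bar x$ such that for every $z\in U$ the following (equivalent) statements all hold: (a) there are $x^*\in\mathcal F$ and $y^*\in\mathbb Y$ such that $x^*$ solves $(P)$, $y^*$ solves $(D)$, and the optimal values of $(P)$ and $(D)$ coincide; (b) there are $x^*\in\mathcal F$ and $y^*\in\mathbb Y$ with $x^*\in\operatorname{argmin}_{x} L_z(x,y^*)$; (c) there is $y^*\in\mathbb Y$ with $0\in A\operatorname{Prox}_{\lambda f}(z+A^*y^*)-b$. -/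

import Mathlib

open Filter Topology
open scoped Pointwise

/-! Extended-real-valued functions on a finite-dimensional Hilbert space are maps `f : X → EReal`. -/

namespace AffineProx

noncomputable section

section Variational

variable {X : Type*} [NormedAddCommGroup X] [InnerProductSpace ℝ X]

/-- The effective domain `{x | f x < +∞}`. -/
def effDom (f : X → EReal) : Set X := {x | f x < ⊤}

/-- `f` is proper: it never takes the value `-∞` and is not identically `+∞`. -/
def Proper (f : X → EReal) : Prop := (∀ x, f x ≠ ⊥) ∧ ∃ x, f x ≠ ⊤

/-- The function `r f`, for a (positive) real `r`. -/
def scale (r : ℝ) (f : X → EReal) : X → EReal := fun x => (r : EReal) * f x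

open Classical in
/-- The indicator function `δ_S`: `0` on `S` and `+∞` off `S`. -/
def indicatorFn (S : Set X) : X → EReal := fun x => if x ∈ S then 0 else ⊤

/-- The set of global minimizers of `g`. -/
def argminSet (g : X → EReal) : Set X := {x | ∀ x', g x ≤ g x'}

/-- The proximal mapping `Prox_f (t) = argmin_x {f x + ½‖x - t‖²}` (set-valued). -/
def prox (f : X → EReal) (t : X) : Set X :=
  argminSet fun x => f x + ((1 / 2 * ‖x - t‖ ^ 2 : ℝ) : EReal)

/-- The Moreau envelope `E_f (t) = inf_x {f x + ½‖x - t‖²}`. -/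
def moreauEnv (f : X → EReal) (t : X) : EReal :=
  ⨅ x, f x + ((1 / 2 * ‖x - t‖ ^ 2 : ℝ) : EReal)

/-- The reals `γ > 0` such that `E_{γ f} (x) > -∞` for some `x`. -/
def proxBoundSet (f : X → EReal) : Set ℝ :=
  {γ | 0 < γ ∧ ∃ x, ⊥ < moreauEnv (scale γ f) x}

/-- `f` is prox-bounded. -/
def ProxBounded (f : X → EReal) : Prop := (proxBoundSet f).Nonempty

/-- The threshold of prox-boundedness (possibly `+∞`). -/
def proxThreshold (f : X → EReal) : EReal := ⨆ γ ∈ proxBoundSet f, (γ : EReal)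

/-- The regular (Fréchet) subdifferential at `x`: `f x` is finite and
`f x' ≥ f x + ⟨v, x' - x⟩ + o(‖x' - x‖)`. -/
def regSubdiff (f : X → EReal) (x : X) : Set X :=
  {v | f x ≠ ⊥ ∧ f x ≠ ⊤ ∧ ∀ ε : ℝ, 0 < ε → ∀ᶠ x' in 𝓝 x,
    f x + ((inner ℝ v (x' - x) - ε * ‖x' - x‖ : ℝ) : EReal) ≤ f x'}

/-- The limiting (Mordukhovich) subdifferential at `x`: `f x` is finite and `v` is a limit of regular
subgradients taken along some sequence `u k → x` with `f (u k) → f x`. -/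
def subdiff (f : X → EReal) (x : X) : Set X :=
  {v | f x ≠ ⊥ ∧ f x ≠ ⊤ ∧ ∃ u w : ℕ → X,
    Tendsto u atTop (𝓝 x) ∧ Tendsto (fun k => f (u k)) atTop (𝓝 (f x)) ∧
    (∀ k, w k ∈ regSubdiff f (u k)) ∧ Tendsto w atTop (𝓝 v)}

/-- `f` is locally lower semicontinuous at `x`: near `x`, the sublevel sets of level at most
`f x + ε` are closed. -/
def LocallyLscAt (f : X → EReal) (x : X) : Prop :=
  ∃ ε : ℝ, 0 < ε ∧ ∀ α : EReal, α ≤ f x + (ε : EReal) →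
    IsClosed (Metric.closedBall x ε ∩ {x' | f x' ≤ α})

/-- `f` is prox-regular at `xb` for `vb` with constant `ρ`. -/
def ProxRegularAt (f : X → EReal) (xb vb : X) (ρ : ℝ) : Prop :=
  f xb ≠ ⊥ ∧ f xb ≠ ⊤ ∧ LocallyLscAt f xb ∧ vb ∈ subdiff f xb ∧
  ∃ ε : ℝ, 0 < ε ∧
    ∀ x ∈ Metric.ball xb ε, f x < f xb + (ε : EReal) →
    ∀ v ∈ subdiff f x ∩ Metric.ball vb ε,
    ∀ x' ∈ Metric.ball xb ε,
      f x + ((inner ℝ v (x' - x) - ρ / 2 * ‖x' - x‖ ^ 2 : ℝ) : EReal) ≤ f x'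

/-- The nonconvex subdifferential sum rule for `f` and `g` at `xb`. -/
def NSSR (f g : X → EReal) (xb : X) : Prop :=
  xb ∈ effDom f ∩ effDom g ∧
  ∃ τ δ : ℝ, 0 < τ ∧ 0 < δ ∧
    ∀ x ∈ Metric.ball xb δ ∩ (effDom f ∩ effDom g), ∀ d : ℝ, 0 < d → d ≤ 1 →
      subdiff (f + g) x ∩ Metric.ball 0 d ⊆
        (subdiff f x ∩ τ • Metric.ball (0 : X) d) + (subdiff g x ∩ τ • Metric.ball (0 : X) d)

end Variational

section Duality

variable {X Y : Type*}
  [NormedAddCommGroup X] [InnerProductSpace ℝ X] [FiniteDimensional ℝ X]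
  [NormedAddCommGroup Y] [InnerProductSpace ℝ Y] [FiniteDimensional ℝ Y]

/-- The affine set `E = {x | A x = b}`. -/
def affineSet (A : X →ₗ[ℝ] Y) (b : Y) : Set X := {x | A x = b}

/-- The feasible set `dom f ∩ E`. -/
def feasibleSet (f : X → EReal) (A : X →ₗ[ℝ] Y) (b : Y) : Set X := effDom f ∩ affineSet A b

/-- The primal objective `lam f(x) + ½‖x - z‖²`. -/
def primalObj (f : X → EReal) (lam : ℝ) (z x : X) : EReal :=
  scale lam f x + ((1 / 2 * ‖x - z‖ ^ 2 : ℝ) : EReal)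

/-- The primal value `v(P)`: the infimum of the primal objective subject to `A x = b`. -/
def primalValue (f : X → EReal) (A : X →ₗ[ℝ] Y) (b : Y) (lam : ℝ) (z : X) : EReal :=
  ⨅ x ∈ affineSet A b, primalObj f lam z x

/-- The Lagrangian `L(x, y) = lam f(x) + ½‖x - z‖² + ⟨y, b - A x⟩`. -/
def lagrangian (f : X → EReal) (A : X →ₗ[ℝ] Y) (b : Y) (lam : ℝ) (z x : X) (y : Y) : EReal :=
  primalObj f lam z x + ((inner ℝ y (b - A x) : ℝ) : EReal)

/-- The function `Φ_z(y) = - inf_x L(x, y)`. -/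
def dualPhi (f : X → EReal) (A : X →ₗ[ℝ] Y) (b : Y) (lam : ℝ) (z : X) (y : Y) : EReal :=
  -⨅ x, lagrangian f A b lam z x y

/-- The dual value `v(D) = - inf_y Φ_z(y)`. -/
def dualValue (f : X → EReal) (A : X →ₗ[ℝ] Y) (b : Y) (lam : ℝ) (z : X) : EReal :=
  -⨅ y, dualPhi f A b lam z y

/-- Attainable strong duality. -/
def AttainableStrongDuality (f : X → EReal) (A : X →ₗ[ℝ] Y) (b : Y) (lam : ℝ) (z : X) : Prop :=
  ∃ xs ∈ feasibleSet f A b, ∃ ys : Y,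
    primalValue f A b lam z = primalObj f lam z xs ∧
    primalObj f lam z xs = -dualPhi f A b lam z ys ∧
    -dualPhi f A b lam z ys = dualValue f A b lam z

/-- Existence of a Lagrangian saddle point. -/
def HasLagrangianSaddlePoint (f : X → EReal) (A : X →ₗ[ℝ] Y) (b : Y) (lam : ℝ) (z : X) : Prop :=
  ∃ xs ∈ feasibleSet f A b, ∃ ys : Y, xs ∈ argminSet fun x => lagrangian f A b lam z x ys

/-- The set-valued map `F(y) = A Prox_{lam f}(z + A* y) - b`. -/
def dualMap (f : X → EReal) (A : X →ₗ[ℝ] Y) (b : Y) (lam : ℝ) (z : X) (y : Y) : Set Y :=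
  (fun x => A x - b) '' prox (scale lam f) (z + LinearMap.adjoint A y)

/-- Solvability of the dual inclusion `0 ∈ F(y)`. -/
def DualInclusionSolvable (f : X → EReal) (A : X →ₗ[ℝ] Y) (b : Y) (lam : ℝ) (z : X) : Prop :=
  ∃ ys : Y, (0 : Y) ∈ dualMap f A b lam z ys

/-- The problem is dual-representable at `z`: dual inclusion, Lagrangian saddle point and attainable
strong duality. These three are equivalent for the functions considered; all three are required, so
that the notion does not rest on that equivalence. -/
def DualRepresentable (f : X → EReal) (A : X →ₗ[ℝ] Y) (b : Y) (lam : ℝ) (z : X) : Prop :=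
  AttainableStrongDuality f A b lam z ∧ HasLagrangianSaddlePoint f A b lam z ∧
    DualInclusionSolvable f A b lam z

end Duality

end

end AffineProx

/-!
The dual multiplier is read off from a solution of the primal problem.

Put `μ = 1 / lam > ρ`. Since `xb` is its own `1 / ρ`-proximal point, `f` has the global quadratic
minorant `f xb - ρ / 2 * ‖x - xb‖ ^ 2`. As `ρ < μ`, this makes `f + μ / 2 * ‖· - z‖ ^ 2` coercive,
so the primal problem has a solution `x`, and it forces `‖x - xb‖ ≤ 2 * μ / (μ - ρ) * ‖z - xb‖`
(`exists_constrained_minimizer`, `norm_sub_le_of_quadratic_minorant`). The vector `μ • (z - x)` is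
then a small subgradient of `f + δ_E` at `x`. The subdifferential sum rule splits it as `v + w`, with
`v` a small subgradient of `f` and `w` in the range of the adjoint of `A`.

It remains to see that `x` is a proximal point of `x + lam • v`, that is
`f x + ⟪v, x' - x⟫ - μ / 2 * ‖x' - x‖ ^ 2 ≤ f x'` for every `x'`. For `x'` near `xb` this is
prox-regularity together with `ρ < μ`. For the other `x'` it follows from the quadratic minorant,
whose gap to the left side is of order `(μ - ρ) * ‖x' - xb‖ ^ 2` and absorbs the small error terms
(`far_estimate`). Writing `w` as the image of a multiplier under the adjoint shows that the dual
inclusion is solvable at `z`. The other two formulations follow by completing the square in the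
Lagrangian (`dualRepresentable_of_mem_prox`).
-/

namespace AffineProx

/-! ### Proximal points and quadratic minorants -/

section Prox

variable {X : Type*} [NormedAddCommGroup X]

theorem eq_top_or_eq_coe {a : EReal} (ha : a ≠ ⊥) : a = ⊤ ∨ ∃ r : ℝ, a = r := by
  induction a with
  | bot => exact absurd rfl ha
  | coe r => exact Or.inr ⟨r, rfl⟩
  | top => exact Or.inl rfl

/-- A fixed point of the proximal mapping of `f / ρ` yields a global concave quadratic minorant. -/
theorem quadratic_minorant_of_mem_prox {f : X → EReal} {ρ : ℝ} (hρ : 0 < ρ) {xb : X} {c : ℝ}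
    (hc : f xb = c) (h : xb ∈ prox (scale (1 / ρ) f) xb) (x : X) (r : ℝ) (hr : f x = r) :
    c - ρ / 2 * ‖x - xb‖ ^ 2 ≤ r := by
  have h1 := h x
  simp only [scale, hc, hr] at h1
  norm_cast at h1
  simp only [sub_self, norm_zero] at h1
  have h2 := mul_le_mul_of_nonneg_left h1 hρ.le
  field_simp at h2
  nlinarith

variable [InnerProductSpace ℝ X]

/-- A global proximal subgradient inequality with constant `1 / lam` exhibits `x` as a proximal point
of `x + lam • v`. -/
theorem mem_prox_of_proximal_inequality {f : X → EReal} (hbot : ∀ x, f x ≠ ⊥) {lam : ℝ}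
    (hlam : 0 < lam) {x v : X} {r : ℝ} (hr : f x = r)
    (h : ∀ x' r', f x' = (r' : ℝ) →
      r + (inner ℝ v (x' - x) - 1 / lam / 2 * ‖x' - x‖ ^ 2) ≤ r') :
    x ∈ prox (scale lam f) (x + lam • v) := by
  intro x'
  rcases eq_top_or_eq_coe (hbot x') with h' | ⟨r', h'⟩
  · simp only [scale, h', EReal.coe_mul_top_of_pos hlam, EReal.top_add_coe, le_top]
  · have h1 := mul_le_mul_of_nonneg_left (h x' r' h') hlam.le
    simp only [scale, hr, h']
    norm_cast
    have e1 : x - (x + lam • v) = -(lam • v) := by abel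
    have e2 : x' - (x + lam • v) = (x' - x) - lam • v := by abel
    rw [e1, e2, norm_neg, norm_sub_sq_real, real_inner_smul_right, real_inner_comm]
    have e3 : lam * (r + (inner ℝ v (x' - x) - 1 / lam / 2 * ‖x' - x‖ ^ 2))
        = lam * r + lam * inner ℝ v (x' - x) - ‖x' - x‖ ^ 2 / 2 := by
      field_simp
      ring
    rw [e3] at h1
    linarith

/-- If the penalized objective at `x` does not exceed its value at `xb`, a concave quadratic
minorant touching `f` at `xb` controls `‖x - xb‖` by `‖z - xb‖`. -/
theorem norm_sub_le_of_quadratic_minorant {ρ μ c r : ℝ} {x xb z : X} (hρ : ρ < μ) (hμ : 0 < μ)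
    (h : c - ρ / 2 * ‖x - xb‖ ^ 2 ≤ r)
    (h' : r + μ / 2 * ‖x - z‖ ^ 2 ≤ c + μ / 2 * ‖xb - z‖ ^ 2) :
    ‖x - xb‖ ≤ 2 * μ / (μ - ρ) * ‖z - xb‖ := by
  have e : x - z = (x - xb) - (z - xb) := by abel
  rw [e, norm_sub_sq_real, norm_sub_rev xb z] at h'
  have h2 := real_inner_le_norm (x - xb) (z - xb)
  have hκ : 0 < μ - ρ := by linarith
  rw [div_mul_eq_mul_div, le_div_iff₀ hκ]
  rcases (norm_nonneg (x - xb)).eq_or_lt with h0 | h0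
  · rw [← h0]
    have := norm_nonneg (z - xb)
    rw [zero_mul]
    positivity
  · have h3 := mul_le_mul_of_nonneg_left h2 hμ.le
    refine le_of_mul_le_mul_left ?_ h0
    nlinarith

/-- Away from `xb`, the quadratic minorant lies above the proximal minorant based at a point `x`
close to `xb`, with a small slope `v`. -/
theorem far_estimate {ρ μ c r ε η : ℝ} {x xb x' v : X} (hρ : 0 < ρ) (hρμ : ρ < μ)
    (hη : 0 ≤ η) (hηε : 8 * μ * η ≤ (μ - ρ) * ε) (hfar : ε ≤ ‖x' - xb‖)
    (hr : r ≤ c + μ / 2 * η ^ 2) (hx : ‖x - xb‖ ≤ η) (hv : ‖v‖ ≤ μ * η) :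
    r + (inner ℝ v (x' - x) - μ / 2 * ‖x' - x‖ ^ 2) ≤ c - ρ / 2 * ‖x' - xb‖ ^ 2 := by
  have e : x' - x = (x' - xb) - (x - xb) := by abel
  have h1 : ‖x' - x‖ ≤ ‖x' - xb‖ + ‖x - xb‖ := by rw [e]; exact norm_sub_le _ _
  have h2 : inner ℝ v (x' - x) ≤ ‖v‖ * ‖x' - x‖ := real_inner_le_norm _ _
  have h3 : ‖x' - x‖ ^ 2 = ‖x' - xb‖ ^ 2 - 2 * inner ℝ (x' - xb) (x - xb) + ‖x - xb‖ ^ 2 := by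
    rw [e, norm_sub_sq_real]
  have h4 := real_inner_le_norm (x' - xb) (x - xb)
  have hμ : 0 < μ := hρ.trans hρμ
  have h5 : inner ℝ v (x' - x) ≤ μ * η * (‖x' - xb‖ + η) :=
    h2.trans (mul_le_mul hv (by linarith) (norm_nonneg _) (by positivity))
  have h6 : inner ℝ (x' - xb) (x - xb) ≤ ‖x' - xb‖ * η :=
    h4.trans (mul_le_mul_of_nonneg_left hx (norm_nonneg _))
  rw [h3]
  generalize ‖x' - xb‖ = a at *
  have ha : 8 * (μ * η) ≤ (μ - ρ) * a := by
    have := mul_le_mul_of_nonneg_left hfar (sub_nonneg.2 hρμ.le)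
    linarith
  have ha0 : 0 ≤ a := by
    have : 0 ≤ μ * η := by positivity
    by_contra hneg
    have := mul_neg_of_pos_of_neg (sub_pos.2 hρμ) (not_le.1 hneg)
    linarith
  have hηa : 8 * η ≤ a := by
    refine le_of_mul_le_mul_left ?_ hμ
    have := mul_nonneg hρ.le ha0
    linarith
  have h7 := mul_le_mul_of_nonneg_right ha ha0
  have h8 := mul_le_mul_of_nonneg_left h6 hμ.le
  have h9 : μ * η * (8 * η) ≤ μ * η * a := mul_le_mul_of_nonneg_left hηa (by positivity)
  have h10 : 0 ≤ μ / 2 * ‖x - xb‖ ^ 2 := by positivity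
  have h11 : 0 ≤ μ * η * a := by positivity
  linarith

end Prox

/-! ### The constrained problem and its first-order condition -/

section Primal

variable {X Y : Type*}
  [NormedAddCommGroup X] [InnerProductSpace ℝ X]
  [NormedAddCommGroup Y] [InnerProductSpace ℝ Y]

/-- First-order condition for a minimizer of the penalized objective on a set `S`. -/
theorem smul_sub_mem_subdiff_add_indicator {f : X → EReal} (hbot : ∀ x, f x ≠ ⊥) {S : Set X}
    {x z : X} {r μ : ℝ} (hμ : 0 < μ) (hx : x ∈ S) (hr : f x = r)
    (hmin : ∀ x' (r' : ℝ), x' ∈ S → f x' = r' →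
      r + μ / 2 * ‖x - z‖ ^ 2 ≤ r' + μ / 2 * ‖x' - z‖ ^ 2) :
    μ • (z - x) ∈ subdiff (f + indicatorFn S) x := by
  have hval : (f + indicatorFn S) x = r := by simp [indicatorFn, hx, hr]
  have hreg : μ • (z - x) ∈ regSubdiff (f + indicatorFn S) x := by
    refine ⟨by simp [hval], by simp [hval], fun ε hε => ?_⟩
    filter_upwards [Metric.ball_mem_nhds x (div_pos hε hμ)] with x' hx'
    rw [hval]
    by_cases hS : x' ∈ S
    · rcases eq_top_or_eq_coe (hbot x') with h | ⟨r', h⟩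
      · simp [indicatorFn, hS, h]
      · have h1 := hmin x' r' hS h
        have e : x' - z = (x' - x) - (z - x) := by abel
        rw [e, norm_sub_sq_real (x' - x), norm_sub_rev x z] at h1
        rw [mem_ball_iff_norm, lt_div_iff₀ hμ] at hx'
        have h2 := mul_le_mul_of_nonneg_right hx'.le (norm_nonneg (x' - x))
        have h3 : 0 ≤ μ * ‖x' - x‖ ^ 2 := by positivity
        simp only [Pi.add_apply, indicatorFn, hS, h, if_true, add_zero]
        norm_cast
        rw [real_inner_smul_left, real_inner_comm]
        linarith
    · simp [indicatorFn, hS, EReal.add_top_of_ne_bot (hbot x')]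
  exact ⟨by simp [hval], by simp [hval], fun _ => x, fun _ => μ • (z - x), tendsto_const_nhds,
    tendsto_const_nhds, fun _ => hreg, tendsto_const_nhds⟩

variable [FiniteDimensional ℝ X]

theorem isClosed_affineSet (A : X →ₗ[ℝ] Y) (b : Y) : IsClosed (affineSet A b) :=
  isClosed_singleton.preimage A.continuous_of_finiteDimensional

/-- A lower semicontinuous function with a sufficiently flat concave quadratic minorant attains the
minimum of its quadratic penalization over an affine set. -/
theorem exists_constrained_minimizer {f : X → EReal} (hbot : ∀ x, f x ≠ ⊥)
    (hlsc : LowerSemicontinuous f) {A : X →ₗ[ℝ] Y} {b : Y} {xb : X} {c ρ μ : ℝ}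
    (hc : f xb = c) (hxb : A xb = b) (hρ : ρ < μ) (hμ : 0 < μ)
    (hq : ∀ x (r : ℝ), f x = r → c - ρ / 2 * ‖x - xb‖ ^ 2 ≤ r) (z : X) :
    ∃ x, ∃ r : ℝ, A x = b ∧ f x = r ∧ ∀ x' (r' : ℝ), A x' = b → f x' = r' →
      r + μ / 2 * ‖x - z‖ ^ 2 ≤ r' + μ / 2 * ‖x' - z‖ ^ 2 := by
  set R := 2 * μ / (μ - ρ) * ‖z - xb‖
  have hR0 : 0 ≤ R := mul_nonneg (div_nonneg (by linarith) (by linarith)) (norm_nonneg _)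
  have hcomp : IsCompact (Metric.closedBall xb R ∩ affineSet A b) :=
    (isCompact_closedBall xb R).inter_right (isClosed_affineSet A b)
  have hmem : xb ∈ Metric.closedBall xb R ∩ affineSet A b := ⟨Metric.mem_closedBall_self hR0, hxb⟩
  have hcont : Continuous fun x : X => ((μ / 2 * ‖x - z‖ ^ 2 : ℝ) : EReal) :=
    continuous_coe_real_ereal.comp (by fun_prop)
  have hg : LowerSemicontinuous fun x => f x + ((μ / 2 * ‖x - z‖ ^ 2 : ℝ) : EReal) :=
    hlsc.add' hcont.lowerSemicontinuous fun x =>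
      EReal.continuousAt_add (Or.inr (EReal.coe_ne_bot _)) (Or.inr (EReal.coe_ne_top _))
  obtain ⟨x, hx, hmin⟩ := (hg.lowerSemicontinuousOn _).exists_isMinOn ⟨xb, hmem⟩ hcomp
  have hxxb : f x + ((μ / 2 * ‖x - z‖ ^ 2 : ℝ) : EReal)
      ≤ f xb + ((μ / 2 * ‖xb - z‖ ^ 2 : ℝ) : EReal) := hmin hmem
  rcases eq_top_or_eq_coe (hbot x) with h | ⟨r, h⟩
  · rw [h, hc, EReal.top_add_coe, ← EReal.coe_add, top_le_iff] at hxxb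
    exact absurd hxxb (EReal.coe_ne_top _)
  refine ⟨x, r, hx.2, h, fun x' r' hx' hr' => ?_⟩
  by_cases hball : x' ∈ Metric.closedBall xb R
  · have h1 : f x + ((μ / 2 * ‖x - z‖ ^ 2 : ℝ) : EReal)
      ≤ f x' + ((μ / 2 * ‖x' - z‖ ^ 2 : ℝ) : EReal) := hmin ⟨hball, hx'⟩
    rw [h, hr'] at h1
    exact_mod_cast h1
  · rw [h, hc] at hxxb
    have h1 : r + μ / 2 * ‖x - z‖ ^ 2 ≤ c + μ / 2 * ‖xb - z‖ ^ 2 := by exact_mod_cast hxxb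
    by_contra! hlt
    refine hball ?_
    rw [mem_closedBall_iff_norm]
    exact norm_sub_le_of_quadratic_minorant hρ hμ (hq x' r' hr') (hlt.le.trans h1)

variable [FiniteDimensional ℝ Y]

/-- A regular normal to `{x | A x = b}` is nonpositive along every direction `h` of `ker A`, hence
along `-h`; so it is orthogonal to `ker A`, and lies in the range of the adjoint. -/
theorem mem_range_adjoint_of_mem_regSubdiff {A : X →ₗ[ℝ] Y} {b : Y} {x v : X}
    (hv : v ∈ regSubdiff (indicatorFn (affineSet A b)) x) :
    v ∈ LinearMap.range (LinearMap.adjoint A) := by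
  obtain ⟨-, htop, hv⟩ := hv
  have hx : x ∈ affineSet A b := by
    by_contra h
    exact htop (by simp [indicatorFn, h])
  rw [← LinearMap.orthogonal_ker]
  have key : ∀ h ∈ LinearMap.ker A, inner ℝ v h ≤ 0 := by
    intro h hh
    refine le_of_forall_pos_le_add fun ε hε => ?_
    have hpos : 0 < ‖h‖ + 1 := by positivity
    have hlim : Tendsto (fun t : ℝ => x + t • h) (𝓝[>] 0) (𝓝 x) := by
      have : Tendsto (fun t : ℝ => x + t • h) (𝓝 0) (𝓝 (x + (0 : ℝ) • h)) :=
        Continuous.tendsto (by fun_prop) 0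
      rw [zero_smul, add_zero] at this
      exact this.mono_left nhdsWithin_le_nhds
    -- with error weight `ε / (‖h‖ + 1)` the error along `h` is at most `ε`, even if `h = 0`
    obtain ⟨t, ht, ht0⟩ := ((hlim.eventually (hv _ (div_pos hε hpos))).and
      self_mem_nhdsWithin).exists
    have ht0 : 0 < t := ht0
    have hxt : x + t • h ∈ affineSet A b := by
      have hx : A x = b := hx
      have hh : A h = 0 := hh
      simp [affineSet, hx, hh]
    simp only [indicatorFn, hx, hxt, if_true, zero_add] at ht
    have ht : inner ℝ v (x + t • h - x) - ε / (‖h‖ + 1) * ‖x + t • h - x‖ ≤ 0 := by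
      exact_mod_cast ht
    rw [add_sub_cancel_left, real_inner_smul_right, norm_smul, Real.norm_of_nonneg ht0.le] at ht
    have h1 : inner ℝ v h - ε / (‖h‖ + 1) * ‖h‖ ≤ 0 := by
      refine le_of_mul_le_mul_left ?_ ht0
      linarith
    have h2 : ε / (‖h‖ + 1) * ‖h‖ ≤ ε := by
      rw [div_mul_eq_mul_div, div_le_iff₀ hpos]
      nlinarith
    linarith
  rw [Submodule.mem_orthogonal']
  intro h hh
  refine le_antisymm (key h hh) ?_
  have := key (-h) (Submodule.neg_mem _ hh)
  rw [inner_neg_right] at this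
  linarith

theorem mem_range_adjoint_of_mem_subdiff {A : X →ₗ[ℝ] Y} {b : Y} {x v : X}
    (hv : v ∈ subdiff (indicatorFn (affineSet A b)) x) :
    v ∈ LinearMap.range (LinearMap.adjoint A) := by
  obtain ⟨-, -, u, w, -, -, hw, hlim⟩ := hv
  exact (Submodule.closed_of_finiteDimensional _).mem_of_tendsto hlim
    (Eventually.of_forall fun k => mem_range_adjoint_of_mem_regSubdiff (hw k))

end Primal

/-! ### From a proximal point to strong duality -/

section Duality

variable {X Y : Type*}
  [NormedAddCommGroup X] [InnerProductSpace ℝ X]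
  [NormedAddCommGroup Y] [InnerProductSpace ℝ Y]

theorem lagrangian_of_mem_affineSet {f : X → EReal} {A : X →ₗ[ℝ] Y} {b : Y} {lam : ℝ} {z x : X}
    (y : Y) (hx : A x = b) : lagrangian f A b lam z x y = primalObj f lam z x := by
  simp [lagrangian, hx]

variable [FiniteDimensional ℝ X] [FiniteDimensional ℝ Y]

/-- Completing the square: up to a constant, the Lagrangian is the objective defining the proximal
mapping at `z + A* y`. -/
theorem lagrangian_eq (f : X → EReal) (A : X →ₗ[ℝ] Y) (b : Y) (lam : ℝ) (z x : X) (y : Y) :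
    lagrangian f A b lam z x y =
      (scale lam f x + ((1 / 2 * ‖x - (z + LinearMap.adjoint A y)‖ ^ 2 : ℝ) : EReal)) +
        ((inner ℝ y b - inner ℝ (LinearMap.adjoint A y) z
          - 1 / 2 * ‖LinearMap.adjoint A y‖ ^ 2 : ℝ) : EReal) := by
  rw [lagrangian, primalObj, add_assoc, add_assoc, ← EReal.coe_add, ← EReal.coe_add]
  congr 2
  have e : x - (z + LinearMap.adjoint A y) = (x - z) - LinearMap.adjoint A y := by abel
  rw [e, norm_sub_sq_real (x - z), real_inner_comm _ (x - z), inner_sub_right, inner_sub_right,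
    LinearMap.adjoint_inner_left A x y]
  ring

theorem dualRepresentable_of_mem_prox {f : X → EReal} {A : X →ₗ[ℝ] Y} {b : Y} {lam : ℝ} {z x : X}
    {y : Y} (hx : x ∈ feasibleSet f A b)
    (h : x ∈ prox (scale lam f) (z + LinearMap.adjoint A y)) :
    DualRepresentable f A b lam z := by
  have hAx : A x = b := hx.2
  have hsaddle : ∀ x', lagrangian f A b lam z x y ≤ lagrangian f A b lam z x' y := by
    intro x'
    rw [lagrangian_eq, lagrangian_eq]
    exact add_le_add_left (h x') _
  have hinf : ⨅ x', lagrangian f A b lam z x' y = primalObj f lam z x := by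
    refine le_antisymm ((iInf_le _ x).trans_eq (lagrangian_of_mem_affineSet y hAx)) (le_iInf ?_)
    intro x'
    rw [← lagrangian_of_mem_affineSet y hAx]
    exact hsaddle x'
  refine ⟨⟨x, hx, y, ?_, ?_, ?_⟩, ⟨x, hx, y, hsaddle⟩, ⟨y, x, h, by simp [hAx]⟩⟩
  · refine le_antisymm (iInf₂_le x hx.2) (le_iInf₂ fun x' hx' => ?_)
    rw [← lagrangian_of_mem_affineSet y hAx, ← lagrangian_of_mem_affineSet y hx']
    exact hsaddle x'
  · rw [dualPhi, neg_neg, hinf]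
  · rw [dualValue]
    congr 1
    refine le_antisymm (le_iInf fun y' => ?_) (iInf_le _ y)
    rw [dualPhi, dualPhi, hinf, EReal.neg_le_neg_iff]
    exact (iInf_le _ x).trans_eq (lagrangian_of_mem_affineSet y' hAx)

end Duality

end AffineProx

theorem mainTheorem1
    {X Y : Type*}
    [NormedAddCommGroup X] [InnerProductSpace ℝ X] [FiniteDimensional ℝ X]
    [NormedAddCommGroup Y] [InnerProductSpace ℝ Y] [FiniteDimensional ℝ Y]
    (f : X → EReal) (A : X →ₗ[ℝ] Y) (b : Y) (lam : ℝ) (hlam : 0 < lam)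
    (hproper : AffineProx.Proper f) (hlsc : LowerSemicontinuous f)
    (hpb : AffineProx.ProxBounded f) (hthr : (lam : EReal) < AffineProx.proxThreshold f)
    (hA : Function.Surjective A)
    (xb : X) (hxb : xb ∈ AffineProx.feasibleSet f A b)
    (hNSSR : AffineProx.NSSR f (AffineProx.indicatorFn (AffineProx.affineSet A b)) xb)
    (ρ : ℝ) (hρ : 0 < ρ) (hρlam : ρ < 1 / lam)
    (hreg : AffineProx.ProxRegularAt f xb 0 ρ)
    (hprox : AffineProx.prox (AffineProx.scale (1 / ρ) f) xb = {xb}) :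
    ∀ᶠ z in 𝓝 xb, AffineProx.DualRepresentable f A b lam z := by
  obtain ⟨hb, ht, -, -, ε, hε, hreg⟩ := hreg
  obtain ⟨-, τ, δ, hτ, hδ, hsum⟩ := hNSSR
  obtain ⟨c, hc⟩ := (AffineProx.eq_top_or_eq_coe hb).resolve_left ht
  have hbot := hproper.1
  have hq := AffineProx.quadratic_minorant_of_mem_prox hρ hc (hprox ▸ Set.mem_singleton xb)
  have hμ : 0 < 1 / lam := by positivity
  have hμlam : lam * (1 / lam) = 1 := by field_simp
  set μ := 1 / lam
  have hκ : 0 < μ - ρ := sub_pos.2 hρlam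
  obtain ⟨η, hη, hηε⟩ : ∃ η : ℝ, 0 < η ∧ 8 * μ * η ≤ (μ - ρ) * ε :=
    ⟨(μ - ρ) * ε / (8 * μ), by positivity, by field_simp; rfl⟩
  -- subgradients of norm below `d` split with a first summand of norm below `min ε (μ * η)`
  obtain ⟨d, hd, hd1, hdε, hdη⟩ : ∃ d : ℝ, 0 < d ∧ d ≤ 1 ∧ τ * d ≤ ε ∧ τ * d ≤ μ * η := by
    refine ⟨min 1 (min (ε / τ) (μ * η / τ)), by positivity, min_le_left _ _, ?_, ?_⟩
    · rw [← le_div_iff₀' hτ]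
      exact (min_le_right _ _).trans (min_le_left _ _)
    · rw [← le_div_iff₀' hτ]
      exact (min_le_right _ _).trans (min_le_right _ _)
  -- Lipschitz constant at `xb` of the solution map of the primal problem
  set L := 2 * μ / (μ - ρ)
  have small : ∀ (g : ℝ → ℝ) (a : ℝ), Continuous g → g 0 < a → ∀ᶠ z in 𝓝 xb, g ‖z - xb‖ < a := by
    intro g a hg h0
    have hlim : Tendsto (fun z => g ‖z - xb‖) (𝓝 xb) (𝓝 (g ‖xb - xb‖)) :=
      Continuous.tendsto (by fun_prop) xb
    rw [sub_self, norm_zero] at hlim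
    exact hlim.eventually (gt_mem_nhds h0)
  filter_upwards [small (fun s => s) η (by fun_prop) hη,
    small (fun s => L * s) η (by fun_prop) (by simpa using hη),
    small (fun s => L * s) δ (by fun_prop) (by simpa using hδ),
    small (fun s => L * s) ε (by fun_prop) (by simpa using hε),
    small (fun s => μ * (s + L * s)) d (by fun_prop) (by simpa using hd),
    small (fun s => μ / 2 * s ^ 2) ε (by fun_prop) (by simpa using hε)]
    with z hz1 hz2 hz3 hz4 hz5 hz6
  obtain ⟨x, r, hxA, hr, hmin⟩ :=
    AffineProx.exists_constrained_minimizer hbot hlsc hc hxb.2 hρlam hμ hq z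
  have hval := hmin xb c hxb.2 hc
  have hdist := AffineProx.norm_sub_le_of_quadratic_minorant hρlam hμ (hq x r hr) hval
  have hrc : r ≤ c + μ / 2 * ‖z - xb‖ ^ 2 := by
    rw [norm_sub_rev xb z] at hval
    have : 0 ≤ μ / 2 * ‖x - z‖ ^ 2 := by positivity
    linarith
  have hxdom : x ∈ AffineProx.effDom f := by
    change f x < ⊤
    rw [hr]
    exact EReal.coe_lt_top r
  have hxE : x ∈ AffineProx.affineSet A b := hxA
  have hsub := AffineProx.smul_sub_mem_subdiff_add_indicator (S := AffineProx.affineSet A b)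
    hbot hμ hxE hr hmin
  have hsmall : μ • (z - x) ∈ Metric.ball (0 : X) d := by
    rw [mem_ball_zero_iff, norm_smul, Real.norm_of_nonneg hμ.le]
    have e : z - x = (z - xb) - (x - xb) := by abel
    have h1 : ‖z - x‖ ≤ ‖z - xb‖ + L * ‖z - xb‖ := by
      rw [e]
      exact (norm_sub_le _ _).trans (by linarith)
    exact (mul_le_mul_of_nonneg_left h1 hμ.le).trans_lt hz5
  have hxδ : x ∈ Metric.ball xb δ := mem_ball_iff_norm.2 (hdist.trans_lt hz3)
  obtain ⟨v, ⟨hv, hvd⟩, w, ⟨hw, -⟩, hvw⟩ := hsum x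
    ⟨hxδ, hxdom, by simp [AffineProx.effDom, AffineProx.indicatorFn, hxE]⟩ d hd hd1 ⟨hsub, hsmall⟩
  have hvnorm : ‖v‖ < τ * d := by
    obtain ⟨v', hv', rfl⟩ := hvd
    rw [mem_ball_zero_iff] at hv'
    simp only [norm_smul, Real.norm_of_nonneg hτ.le]
    exact mul_lt_mul_of_pos_left hv' hτ
  obtain ⟨y, hy⟩ := AffineProx.mem_range_adjoint_of_mem_subdiff hw
  have hfx : f x < f xb + (ε : EReal) := by
    rw [hr, hc]
    norm_cast
    linarith
  have hproxx : x ∈ AffineProx.prox (AffineProx.scale lam f) (x + lam • v) := by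
    refine AffineProx.mem_prox_of_proximal_inequality hbot hlam hr fun x' r' hr' => ?_
    by_cases hball : x' ∈ Metric.ball xb ε
    · have h1 := hreg x (mem_ball_iff_norm.2 (hdist.trans_lt hz4)) hfx v
        ⟨hv, mem_ball_zero_iff.2 (hvnorm.trans_le hdε)⟩ x' hball
      rw [hr, hr'] at h1
      norm_cast at h1
      have h2 := mul_le_mul_of_nonneg_right hρlam.le (sq_nonneg ‖x' - x‖)
      linarith
    · rw [mem_ball_iff_norm, not_lt] at hball
      refine (AffineProx.far_estimate hρ hρlam hη.le hηε hball ?_ (hdist.trans hz2.le)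
        (hvnorm.le.trans hdη)).trans (hq x' r' hr')
      have : ‖z - xb‖ ^ 2 ≤ η ^ 2 := pow_le_pow_left₀ (norm_nonneg _) hz1.le 2
      have := mul_le_mul_of_nonneg_left this (half_pos hμ).le
      linarith
  -- scaling `v + A* y = μ • (z - x)` by `lam` identifies the multiplier as `-lam • y`
  have hpoint : x + lam • v = z + LinearMap.adjoint A (-(lam • y)) := by
    have h1 : lam • (v + w) = z - x := by
      have hvw : v + w = μ • (z - x) := hvw
      rw [hvw, smul_smul, hμlam, one_smul]
    rw [map_neg, map_smul, hy]
    rw [smul_add] at h1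
    rw [eq_sub_of_add_eq h1]
    abel
  rw [hpoint] at hproxx
  exact AffineProx.dualRepresentable_of_mem_prox ⟨hxdom, hxE⟩ hproxx
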